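/- For Borel probability measures $\mu,\nu$ on $[0,1]$ let $D^*(\mu;\nu)=\sup_{0\le b\le 1}|\mu([0,b))-\nu([0,b))|$ denote the star-discrepancy, and for points $x_1,\dots,x_N\in[0,1]$ (not necessarily distinct, $N\ge 1$) let $\nu_N=\frac1N\sum_{i=1}^N\delta_{x_i}$. There are absolute constants $c_1,c_2,c_3>0$ such that the following holds for every Borel probability measure $\mu$ on $[0,1]$. (1) For every integer $N\ge 1$ there are points $x_1,\dots,x_N\in[0,1]$ with $D^*(\mu;\nu_N)\le \frac{c_1}{N}$. (2) There is an infinite sequence $(x_k)_{k\ge1}$ in $[0,1]$ such that, with $\nu_N=\frac1N\sum_{i=1}^N\delta_{x_i}$ formed from its first $N$ terms, $D^*(\mu;\nu_N)\le c_2\frac{\log N}{N}$ for all integers $N\ge2$. (3) Suppose that $\mu$ has no point masses, i.e. $\mu(\{y\})=0$ for all $y\in[0,1]$. Then $D^*(\mu;\nu_N)\ge\frac1{2N}$ for every $N\ge1$ and all points $x_1,\dots,x_N\in[0,1]$. Moreover, for every infinite sequence $(x_k)_{k\ge1}$ in $[0,1]$, the inequality $D^*(\mu;\nu_N)\ge c_3\frac{\log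 N}{N}$ holds for infinitely many $N$, where $\nu_N$ is formed from the first $N$ terms. -/

import Mathlib

open MeasureTheory
open scoped ENNReal

noncomputable section

/-- The probability measure `ν_N = (1/N) ∑ δ_{x_i}` associated to a finite family of `N` points of
`[0,1]` (repetitions allowed). -/
def empiricalMeasure {N : ℕ} (x : Fin N → unitInterval) : Measure unitInterval :=
  (N : ℝ≥0∞)⁻¹ • ∑ i, Measure.dirac (x i)

/-- The star-discrepancy between two (probability) measures on `[0,1]`: the supremum of
`|μ(A) - ν(A)|` over the half-open intervals `A = [0,b)` contained in `[0,1]`, that is, over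
`0 ≤ b ≤ 1`. In the type `unitInterval` the interval `[0,b)` is `Set.Iio b`. -/
def starDiscrepancy (μ ν : Measure unitInterval) : ℝ :=
  ⨆ b : unitInterval, |μ.real (Set.Iio b) - ν.real (Set.Iio b)|

end

/-!
Write `G b = μ [0,b)`. The function `G` and its generalised inverse, the quantile function of `μ`,
reduce all the bounds to the uniform distribution on `[0,1]`.

*Upper bounds.* Since `G` is left continuous, `quantile μ u < b ↔ u < G b`, even if `μ` has atoms
(`quantile_lt_iff`). So the quantile transform of a sequence with local discrepancy at most `C` is
within `C / N` of `μ` (`starDiscrepancy_quantile_le`). The points `k / N` have `C = 1`; the van der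
Corput sequence has `C = O(log N)`, because its even-indexed and odd-indexed terms are copies of
the sequence in the two halves of the unit interval, so that halving `N` costs at most `1`.

*Lower bounds.* If `μ` has no atoms, `G` is continuous and takes every value `t` in `[0,1]`, so the
star-discrepancy of `x` from `μ` is at least that of the sequence `G (x k)` from the uniform
distribution. The level `t = 1 / (2N)` gives the bound `1 / (2N)`. The logarithmic bound is Schmidt's
theorem: for every sequence in `[0,1]` the maximum of the local discrepancy over times below `4 ^ T`
grows linearly in `T`. The proof follows the oscillation over a block of `4 ^ s` times of the local
discrepancy `D(n,t)`, averaged over `t` in a fine grid. The oscillation over a block is at least the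
mean of the oscillations over its first and last quarters plus the distance of the mid-ranges over
these quarters (`oscillationOn_superset_ge`). If no term of the block lies in `[t,t')`, then
`D(n,t') - D(n,t)` falls linearly in `n`, which keeps the mid-ranges apart at `t` or at `t'`
(`le_abs_midrangeOn_sub_add`); intervals of length a small multiple of `1 / 4 ^ s` are empty for
at least half of the positions. So each step `s → s + 1` adds a constant to the average
(`sum_oscillationOn_ge`).
-/

/-! ### Counting function and local discrepancy -/

/-- The local discrepancy `#{k < N : u k < t} - N t` of the first `N` terms of `u` at `t`, not
normalised by `N`. -/
noncomputable def localDiscrepancy (u : ℕ → ℝ) (N : ℕ) (t : ℝ) : ℝ :=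
  (∑ k ∈ Finset.range N, if u k < t then (1 : ℝ) else 0) - N * t

theorem empiricalMeasure_real_Iio {N : ℕ} (x : Fin N → unitInterval) (b : unitInterval) :
    (empiricalMeasure x).real (Set.Iio b) = (∑ i, if x i < b then (1 : ℝ) else 0) / N := by
  have h : (∑ i, Measure.dirac (x i)) (Set.Iio b) = ∑ i, if x i < b then (1 : ℝ≥0∞) else 0 := by
    rw [Measure.finsetSum_apply]
    refine Finset.sum_congr rfl fun i _ => ?_
    rw [Measure.dirac_apply' _ measurableSet_Iio]
    simp [Set.indicator_apply]
  rw [empiricalMeasure, Measure.real, Measure.smul_apply, h, smul_eq_mul, ENNReal.toReal_mul,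
    ENNReal.toReal_sum (by intro i _; split_ifs <;> simp), ENNReal.toReal_inv,
    ENNReal.toReal_natCast, div_eq_inv_mul]
  congr 1
  refine Finset.sum_congr rfl fun i _ => ?_
  split_ifs <;> simp

theorem abs_sub_empiricalMeasure_real_Iio (μ : Measure unitInterval) {u : ℕ → ℝ}
    {x : ℕ → unitInterval} {N : ℕ} (hN : 1 ≤ N) {b : unitInterval} {t : ℝ}
    (h : ∀ k, x k < b ↔ u k < t) (ht : μ.real (Set.Iio b) = t) :
    |μ.real (Set.Iio b) - (empiricalMeasure fun i : Fin N => x i).real (Set.Iio b)|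
      = |localDiscrepancy u N t| / N := by
  have hN' : (0 : ℝ) < N := by exact_mod_cast hN
  rw [empiricalMeasure_real_Iio, ht,
    Fin.sum_univ_eq_sum_range (fun i => if x i < b then (1 : ℝ) else 0),
    ← abs_of_pos hN', ← abs_div, abs_of_pos hN', abs_sub_comm, localDiscrepancy]
  congr 1
  simp only [h]
  field_simp

theorem abs_sub_empiricalMeasure_real_le_one (μ : Measure unitInterval) [IsProbabilityMeasure μ]
    {N : ℕ} (x : Fin N → unitInterval) (b : unitInterval) :
    |μ.real (Set.Iio b) - (empiricalMeasure x).real (Set.Iio b)| ≤ 1 := by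
  have h0 : (∑ i, if x i < b then (1 : ℝ) else 0) ≤ N := by
    calc _ ≤ ∑ i : Fin N, (1 : ℝ) := Finset.sum_le_sum fun i _ => by split_ifs <;> norm_num
      _ = N := by simp
  have h1 : (∑ i, if x i < b then (1 : ℝ) else 0) / N ≤ 1 := div_le_one_of_le₀ h0 (by positivity)
  have h2 : 0 ≤ (∑ i, if x i < b then (1 : ℝ) else 0) / N :=
    div_nonneg (Finset.sum_nonneg fun i _ => by split_ifs <;> norm_num) (by positivity)
  rw [empiricalMeasure_real_Iio, abs_le]
  constructor <;> linarith [measureReal_nonneg (μ := μ) (s := Set.Iio b),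
    measureReal_le_one (μ := μ) (s := Set.Iio b)]

theorem le_starDiscrepancy (μ : Measure unitInterval) [IsProbabilityMeasure μ]
    {N : ℕ} (x : Fin N → unitInterval) (b : unitInterval) :
    |μ.real (Set.Iio b) - (empiricalMeasure x).real (Set.Iio b)|
      ≤ starDiscrepancy μ (empiricalMeasure x) :=
  le_ciSup (f := fun b => |μ.real (Set.Iio b) - (empiricalMeasure x).real (Set.Iio b)|)
    ⟨1, by rintro _ ⟨b, rfl⟩; exact abs_sub_empiricalMeasure_real_le_one μ x b⟩ b

theorem starDiscrepancy_le_one (μ : Measure unitInterval) [IsProbabilityMeasure μ]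
    {N : ℕ} (x : Fin N → unitInterval) : starDiscrepancy μ (empiricalMeasure x) ≤ 1 :=
  ciSup_le fun b => abs_sub_empiricalMeasure_real_le_one μ x b

/-! ### Quantile transforms -/

/-- The quantile function of `μ`, adapted to the half-open intervals `[0,b)`: the infimum of the
`b` with `u < μ [0,b)`, which is `1` if there is no such `b`. -/
noncomputable def quantile (μ : Measure unitInterval) (u : ℝ) : unitInterval :=
  sInf {b | u < μ.real (Set.Iio b)}

theorem measureReal_Iio_mono (μ : Measure unitInterval) [IsProbabilityMeasure μ] :
    Monotone fun b : unitInterval => μ.real (Set.Iio b) :=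
  fun _ _ h => measureReal_mono (Set.Iio_subset_Iio h)

/-- Left continuity of `b ↦ μ [0,b)`, in the form in which it gives `quantile_lt_iff`. -/
theorem exists_lt_measureReal_Iio (μ : Measure unitInterval) [IsProbabilityMeasure μ] {u : ℝ}
    (hu : 0 ≤ u) {b : unitInterval} (h : u < μ.real (Set.Iio b)) :
    ∃ a < b, u < μ.real (Set.Iio a) := by
  have hb : 0 < b := by
    rw [pos_iff_ne_zero]
    rintro rfl
    have : Set.Iio (0 : unitInterval) = ∅ := Set.Iio_bot
    rw [this, measureReal_empty] at h
    linarith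
  obtain ⟨s, hs, hsb, hst⟩ := exists_seq_strictMono_tendsto' hb
  have hU : Set.Iio b = ⋃ n, Set.Iio (s n) := by
    ext y
    simp only [Set.mem_Iio, Set.mem_iUnion]
    refine ⟨fun hy => ((hst.eventually (lt_mem_nhds hy)).exists), ?_⟩
    rintro ⟨n, hn⟩
    exact hn.trans (hsb n).2
  have hm : Monotone fun n => Set.Iio (s n) :=
    fun _ _ h => Set.Iio_subset_Iio (hs.monotone h)
  have ht := tendsto_measure_iUnion_atTop (μ := μ) hm
  rw [← hU] at ht
  have ht' := (ENNReal.tendsto_toReal (measure_ne_top μ _)).comp ht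
  obtain ⟨n, hn⟩ := (ht'.eventually (lt_mem_nhds h)).exists
  exact ⟨s n, (hsb n).2, hn⟩

theorem quantile_lt_iff (μ : Measure unitInterval) [IsProbabilityMeasure μ] {u : ℝ}
    (hu : 0 ≤ u) (b : unitInterval) : quantile μ u < b ↔ u < μ.real (Set.Iio b) := by
  constructor
  · intro h
    obtain ⟨a, ha, hab⟩ := sInf_lt_iff.1 h
    exact lt_of_lt_of_le ha (measureReal_Iio_mono μ hab.le)
  · intro h
    obtain ⟨a, hab, ha⟩ := exists_lt_measureReal_Iio μ hu h
    exact lt_of_le_of_lt (sInf_le ha) hab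

/-- The quantile transform turns the discrepancy of `u` from the uniform distribution into that
of `quantile μ ∘ u` from `μ`, also when `μ` has atoms. -/
theorem starDiscrepancy_quantile_le (μ : Measure unitInterval) [IsProbabilityMeasure μ]
    {u : ℕ → ℝ} (hu : ∀ k, 0 ≤ u k) {N : ℕ} (hN : 1 ≤ N) {C : ℝ}
    (hC : ∀ t, 0 ≤ t → t ≤ 1 → |localDiscrepancy u N t| ≤ C) :
    starDiscrepancy μ (empiricalMeasure fun i : Fin N => quantile μ (u i)) ≤ C / N := by
  refine ciSup_le fun b => ?_
  rw [abs_sub_empiricalMeasure_real_Iio μ (x := fun k => quantile μ (u k)) hN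
    (fun k => quantile_lt_iff μ (hu k) b) rfl]
  gcongr
  exact hC _ measureReal_nonneg measureReal_le_one

theorem continuous_measureReal_Iio (μ : Measure unitInterval) [IsProbabilityMeasure μ]
    (hμ : ∀ y, μ {y} = 0) : Continuous fun b : unitInterval => μ.real (Set.Iio b) := by
  have h : (fun b : unitInterval => μ.real (Set.Iio b))
      = fun b => ∫ y, (Set.Iio b).indicator (fun _ => (1 : ℝ)) y ∂μ := by
    funext b
    rw [integral_indicator measurableSet_Iio]
    simp
  rw [h, continuous_iff_continuousAt]
  intro b
  refine continuousAt_of_dominated (bound := fun _ => 1) ?_ ?_ (integrable_const _) ?_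
  · exact Filter.Eventually.of_forall fun c =>
      (measurable_const.indicator measurableSet_Iio).aestronglyMeasurable
  · refine Filter.Eventually.of_forall fun c => Filter.Eventually.of_forall fun y => ?_
    rw [Set.indicator_apply]
    split_ifs <;> simp
  · -- The integrand is locally constant in `b` at every `y ≠ b`, that is, almost everywhere.
    have hb : ∀ᵐ y ∂μ, y ≠ b := by
      rw [ae_iff]
      simpa using hμ b
    filter_upwards [hb] with y hy
    rcases lt_or_gt_of_ne hy with hlt | hgt
    · refine (continuousAt_const (y := (1 : ℝ))).congr ?_
      filter_upwards [lt_mem_nhds hlt] with c hc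
      rw [Set.indicator_of_mem (show y ∈ Set.Iio c from hc)]
    · refine (continuousAt_const (y := (0 : ℝ))).congr ?_
      filter_upwards [gt_mem_nhds hgt] with c hc
      rw [Set.indicator_of_notMem (show y ∉ Set.Iio c from not_lt.2 (le_of_lt hc))]

/-- If `μ` has no atoms, then for every level `t ∈ [0,1]` some `b` has `μ [0,b) = t`, and the least
such `b` satisfies `x < b ↔ μ [0,x) < t`. -/
theorem exists_measureReal_Iio_eq (μ : Measure unitInterval) [IsProbabilityMeasure μ]
    (hμ : ∀ y, μ {y} = 0) {t : ℝ} (h0 : 0 ≤ t) (h1 : t ≤ 1) :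
    ∃ b : unitInterval, μ.real (Set.Iio b) = t ∧ ∀ x, x < b ↔ μ.real (Set.Iio x) < t := by
  have hc := continuous_measureReal_Iio μ hμ
  have hz : μ.real (Set.Iio (0 : unitInterval)) = 0 := by
    have : Set.Iio (0 : unitInterval) = ∅ := Set.Iio_bot
    rw [this, measureReal_empty]
  have ho : μ.real (Set.Iio (1 : unitInterval)) = 1 := by
    have : Set.Iio (1 : unitInterval) = {1}ᶜ := by
      ext y
      exact lt_top_iff_ne_top (a := y)
    rw [this, probReal_compl_eq_one_sub (measurableSet_singleton _), Measure.real, hμ]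
    simp
  obtain ⟨b₀, hb₀⟩ :=
    mem_range_of_exists_le_of_exists_ge hc ⟨0, hz.trans_le h0⟩ ⟨1, h1.trans_eq ho.symm⟩
  set S := {b : unitInterval | μ.real (Set.Iio b) = t} with hS
  have hcl : IsClosed S := isClosed_eq hc continuous_const
  have hmem : sInf S ∈ S := hcl.sInf_mem ⟨b₀, hb₀⟩
  refine ⟨sInf S, hmem, fun x => ⟨fun h => ?_, fun h => ?_⟩⟩
  · refine lt_of_le_of_ne ((measureReal_Iio_mono μ h.le).trans_eq hmem) fun he => ?_
    exact absurd (sInf_le (show x ∈ S from he)) (not_le.2 h)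
  · by_contra hx
    have := measureReal_Iio_mono μ (not_lt.1 hx)
    have h2 : μ.real (Set.Iio (sInf S)) = t := hmem
    simp only at this
    linarith

theorem abs_localDiscrepancy_le_starDiscrepancy (μ : Measure unitInterval)
    [IsProbabilityMeasure μ] (hμ : ∀ y, μ {y} = 0) (x : ℕ → unitInterval) {N : ℕ} (hN : 1 ≤ N)
    {t : ℝ} (h0 : 0 ≤ t) (h1 : t ≤ 1) :
    |localDiscrepancy (fun k => μ.real (Set.Iio (x k))) N t| / N
      ≤ starDiscrepancy μ (empiricalMeasure fun i : Fin N => x i) := by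
  obtain ⟨b, hb, hx⟩ := exists_measureReal_Iio_eq μ hμ h0 h1
  rw [← abs_sub_empiricalMeasure_real_Iio μ hN (fun k => hx (x k)) hb]
  exact le_starDiscrepancy μ _ b

/-! ### Upper bounds: equally spaced points and the van der Corput sequence -/

theorem abs_localDiscrepancy_equispaced_le {N : ℕ} (hN : 1 ≤ N) {t : ℝ} (h0 : 0 ≤ t)
    (h1 : t ≤ 1) : |localDiscrepancy (fun k => (k : ℝ) / N) N t| ≤ 1 := by
  have hN' : (0 : ℝ) < N := by exact_mod_cast hN
  have hfil : (Finset.range N).filter (fun k : ℕ => (k : ℝ) / N < t) = Finset.range ⌈N * t⌉₊ := by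
    ext k
    simp only [Finset.mem_filter, Finset.mem_range, Nat.lt_ceil, div_lt_iff₀ hN', mul_comm t]
    refine ⟨fun h => h.2, fun h => ⟨?_, h⟩⟩
    have : (k : ℝ) < N := h.trans_le (mul_le_of_le_one_right hN'.le h1)
    exact_mod_cast this
  rw [localDiscrepancy, Finset.sum_boole, hfil, Finset.card_range, abs_le]
  have h2 := Nat.le_ceil (N * t)
  have h3 := Nat.ceil_lt_add_one (mul_nonneg hN'.le h0)
  constructor <;> linarith

/-- The van der Corput sequence in base `2`: reflect the binary digits of `n` in the point. -/
noncomputable def vanDerCorput (n : ℕ) : ℝ :=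
  if h : n = 0 then 0 else (vanDerCorput (n / 2) + (n % 2 : ℕ)) / 2
decreasing_by omega

theorem vanDerCorput_two_mul (n : ℕ) : vanDerCorput (2 * n) = vanDerCorput n / 2 := by
  rcases Nat.eq_zero_or_pos n with rfl | hn
  · simp [vanDerCorput]
  · rw [vanDerCorput, dif_neg (by omega)]
    simp

theorem vanDerCorput_two_mul_add_one (n : ℕ) :
    vanDerCorput (2 * n + 1) = (vanDerCorput n + 1) / 2 := by
  rw [vanDerCorput, dif_neg (by omega), show (2 * n + 1) / 2 = n by omega,
    show (2 * n + 1) % 2 = 1 by omega, Nat.cast_one]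

theorem vanDerCorput_nonneg_and_lt_one (n : ℕ) : 0 ≤ vanDerCorput n ∧ vanDerCorput n < 1 := by
  induction n using Nat.strong_induction_on with
  | _ n ih =>
    rcases Nat.eq_zero_or_pos n with rfl | hn
    · simp [vanDerCorput]
    rcases Nat.even_or_odd' n with ⟨m, rfl | rfl⟩
    · rw [vanDerCorput_two_mul]
      have := ih m (by omega)
      constructor <;> linarith
    · rw [vanDerCorput_two_mul_add_one]
      have := ih m (by omega)
      constructor <;> linarith

theorem sum_range_two_mul (f : ℕ → ℝ) (m : ℕ) :
    ∑ k ∈ Finset.range (2 * m), f k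
      = ∑ k ∈ Finset.range m, f (2 * k) + ∑ k ∈ Finset.range m, f (2 * k + 1) := by
  induction m with
  | zero => simp
  | succ m ih =>
    rw [show 2 * (m + 1) = 2 * m + 1 + 1 by ring, Finset.sum_range_succ, Finset.sum_range_succ, ih,
      Finset.sum_range_succ, Finset.sum_range_succ]
    ring

/-- The even-indexed terms are a copy of the sequence in `[0,1/2)`, the odd-indexed ones lie in
`[1/2,1)`. -/
theorem localDiscrepancy_vanDerCorput_of_le_half (p q : ℕ) (hpq : p = q ∨ p = q + 1) {t : ℝ}
    (ht : t ≤ 1 / 2) :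
    localDiscrepancy vanDerCorput (p + q) t
      = localDiscrepancy vanDerCorput p (2 * t) + (p - q) * t := by
  have he : ∀ k, (if vanDerCorput (2 * k) < t then (1 : ℝ) else 0)
      = if vanDerCorput k < 2 * t then 1 else 0 := fun k => by
    rw [vanDerCorput_two_mul]
    congr 1
    exact propext ⟨fun h => by linarith, fun h => by linarith⟩
  have ho : ∀ k, (if vanDerCorput (2 * k + 1) < t then (1 : ℝ) else 0) = 0 := fun k => by
    rw [vanDerCorput_two_mul_add_one, if_neg]
    linarith [(vanDerCorput_nonneg_and_lt_one k).1]
  rcases hpq with rfl | rfl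
  · rw [localDiscrepancy, localDiscrepancy, ← two_mul, sum_range_two_mul]
    simp only [he, ho]
    push_cast
    simp
    ring
  · rw [localDiscrepancy, localDiscrepancy, show q + 1 + q = 2 * q + 1 by ring,
      Finset.sum_range_succ, sum_range_two_mul, Finset.sum_range_succ]
    simp only [he, ho]
    push_cast
    simp
    ring

theorem localDiscrepancy_vanDerCorput_of_half_lt (p q : ℕ) (hpq : p = q ∨ p = q + 1) {t : ℝ}
    (ht : 1 / 2 < t) :
    localDiscrepancy vanDerCorput (p + q) t
      = localDiscrepancy vanDerCorput q (2 * t - 1) + (p - q) * (1 - t) := by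
  have he : ∀ k, (if vanDerCorput (2 * k) < t then (1 : ℝ) else 0) = 1 := fun k => by
    rw [vanDerCorput_two_mul, if_pos]
    linarith [(vanDerCorput_nonneg_and_lt_one k).2]
  have ho : ∀ k, (if vanDerCorput (2 * k + 1) < t then (1 : ℝ) else 0)
      = if vanDerCorput k < 2 * t - 1 then 1 else 0 := fun k => by
    rw [vanDerCorput_two_mul_add_one]
    congr 1
    exact propext ⟨fun h => by linarith, fun h => by linarith⟩
  rcases hpq with rfl | rfl
  · rw [localDiscrepancy, localDiscrepancy, ← two_mul, sum_range_two_mul]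
    simp only [he, ho]
    push_cast
    simp
    ring
  · rw [localDiscrepancy, localDiscrepancy, show q + 1 + q = 2 * q + 1 by ring,
      Finset.sum_range_succ, sum_range_two_mul]
    simp only [he, ho]
    push_cast
    simp
    ring

theorem abs_localDiscrepancy_vanDerCorput_le (m : ℕ) :
    ∀ N ≤ 2 ^ m, ∀ t : ℝ, 0 ≤ t → t ≤ 1 → |localDiscrepancy vanDerCorput N t| ≤ m + 1 := by
  induction m with
  | zero =>
    intro N hN t h0 h1
    have hN' : N = 0 ∨ N = 1 := by simp at hN; omega
    rcases hN' with rfl | rfl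
    · simp [localDiscrepancy]
    · simp only [localDiscrepancy, Finset.sum_range_one]
      rw [abs_le]
      split_ifs <;> push_cast <;> constructor <;> linarith
  | succ m ih =>
    intro N hN t h0 h1
    rw [pow_succ] at hN
    obtain ⟨p, q, hpq, rfl⟩ : ∃ p q, (p = q ∨ p = q + 1) ∧ N = p + q :=
      ⟨(N + 1) / 2, N / 2, by omega, by omega⟩
    have hd : (0 : ℝ) ≤ p - q ∧ (p : ℝ) - q ≤ 1 := by
      rcases hpq with rfl | rfl <;> push_cast <;> constructor <;> linarith
    rcases le_or_gt t (1 / 2) with ht | ht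
    · rw [localDiscrepancy_vanDerCorput_of_le_half p q hpq ht]
      have h2 := abs_le.1 (ih p (by omega) (2 * t) (by linarith) (by linarith))
      rw [abs_le]
      push_cast
      constructor <;> nlinarith
    · rw [localDiscrepancy_vanDerCorput_of_half_lt p q hpq ht]
      have h2 := abs_le.1 (ih q (by omega) (2 * t - 1) (by linarith) (by linarith))
      rw [abs_le]
      push_cast
      constructor <;> nlinarith

theorem abs_localDiscrepancy_vanDerCorput_le_log {N : ℕ} (hN : 2 ≤ N) {t : ℝ} (h0 : 0 ≤ t)
    (h1 : t ≤ 1) : |localDiscrepancy vanDerCorput N t| ≤ 5 * Real.log N := by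
  have hl := Real.log_two_gt_d9
  have hN2 : Real.log 2 ≤ Real.log N := Real.log_le_log (by norm_num) (by exact_mod_cast hN)
  have hp : (2 ^ Nat.log 2 N : ℝ) ≤ N := by exact_mod_cast Nat.pow_log_le_self 2 (by omega : N ≠ 0)
  have hlog : Nat.log 2 N * Real.log 2 ≤ Real.log N := by
    rw [← Real.log_pow]
    exact Real.log_le_log (by positivity) hp
  have h := abs_localDiscrepancy_vanDerCorput_le (Nat.log 2 N + 1) N
    (Nat.lt_pow_succ_log_self (by norm_num) N).le t h0 h1
  push_cast at h
  nlinarith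

/-! ### Oscillation and mid-range over a finite set of times -/

/-- The oscillation `max f - min f` of `f` over a nonempty finite set. -/
noncomputable def oscillationOn (L : Finset ℕ) (hL : L.Nonempty) (f : ℕ → ℝ) : ℝ :=
  L.sup' hL f - L.inf' hL f

/-- The mid-range `(max f + min f) / 2` of `f` over a nonempty finite set. -/
noncomputable def midrangeOn (L : Finset ℕ) (hL : L.Nonempty) (f : ℕ → ℝ) : ℝ :=
  (L.sup' hL f + L.inf' hL f) / 2

theorem oscillationOn_nonneg (L : Finset ℕ) (hL : L.Nonempty) (f : ℕ → ℝ) :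
    0 ≤ oscillationOn L hL f := by
  obtain ⟨n, hn⟩ := hL
  have h1 := Finset.le_sup' f hn
  have h2 := Finset.inf'_le f hn
  unfold oscillationOn
  linarith

/-- The oscillation over `M` exceeds the average of the oscillations over two parts of `M` by at
least the distance of the mid-ranges: it bounds both `max_L f - min_{L'} f` and
`max_{L'} f - min_L f`. -/
theorem oscillationOn_superset_ge {L L' M : Finset ℕ} (hL : L.Nonempty) (hL' : L'.Nonempty)
    (hM : M.Nonempty) (h : L ⊆ M) (h' : L' ⊆ M) (f : ℕ → ℝ) :
    (oscillationOn L hL f + oscillationOn L' hL' f) / 2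
      + |midrangeOn L hL f - midrangeOn L' hL' f| ≤ oscillationOn M hM f := by
  have h1 := Finset.sup'_mono f h hL
  have h2 := Finset.sup'_mono f h' hL'
  have h3 := Finset.inf'_mono f h hL
  have h4 := Finset.inf'_mono f h' hL'
  simp only [oscillationOn, midrangeOn]
  rcases abs_cases ((L.sup' hL f + L.inf' hL f) / 2 - (L'.sup' hL' f + L'.inf' hL' f) / 2)
    with ⟨h5, _⟩ | ⟨h5, _⟩ <;> rw [h5] <;> linarith

theorem midrangeOn_add_le {L : Finset ℕ} (hL : L.Nonempty) {f g : ℕ → ℝ} {c : ℝ}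
    (h : ∀ n ∈ L, f n + c ≤ g n) : midrangeOn L hL f + c ≤ midrangeOn L hL g := by
  have h1 : L.sup' hL f ≤ L.sup' hL g - c := by
    refine Finset.sup'_le _ _ fun n hn => ?_
    linarith [h n hn, Finset.le_sup' g hn]
  have h2 : L.inf' hL f + c ≤ L.inf' hL g := by
    refine Finset.le_inf' _ _ fun n hn => ?_
    linarith [h n hn, Finset.inf'_le f hn]
  rw [midrangeOn, midrangeOn]
  linarith

/-- If `g - f` is larger on `L` than on `L'` by `c`, then the mid-ranges over `L` and `L'` cannot
be close to each other for both `f` and `g`. -/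
theorem le_abs_midrangeOn_sub_add {L L' : Finset ℕ} (hL : L.Nonempty) (hL' : L'.Nonempty)
    {f g : ℕ → ℝ} {c : ℝ} (h : ∀ n ∈ L, ∀ n' ∈ L', c ≤ (g n - f n) - (g n' - f n')) :
    c ≤ |midrangeOn L hL f - midrangeOn L' hL' f| + |midrangeOn L hL g - midrangeOn L' hL' g| := by
  obtain ⟨m, hm, hmin⟩ := L.exists_min_image (fun n => g n - f n) hL
  have h1 := midrangeOn_add_le hL (f := f) (g := g) (c := g m - f m)
    fun n hn => by linarith [hmin n hn]
  have h2 := midrangeOn_add_le hL' (f := g) (g := f) (c := c - (g m - f m))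
    fun n hn => by linarith [h m hm n hn]
  have h3 := neg_abs_le (midrangeOn L hL f - midrangeOn L' hL' f)
  have h4 := le_abs_self (midrangeOn L hL g - midrangeOn L' hL' g)
  linarith

/-! ### Schmidt's lower bound for sequences -/

theorem localDiscrepancy_sub (u : ℕ → ℝ) {n m : ℕ} (h : n ≤ m) (t : ℝ) :
    localDiscrepancy u m t - localDiscrepancy u n t
      = (∑ k ∈ Finset.Ico n m, if u k < t then (1 : ℝ) else 0) - (m - n) * t := by
  rw [Finset.sum_Ico_eq_sub _ h, localDiscrepancy, localDiscrepancy]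
  ring

/-- While no term of `u` falls into `[t,t')`, the local discrepancy of this interval decreases
linearly. -/
theorem localDiscrepancy_interval_sub (u : ℕ → ℝ) {n m : ℕ} (h : n ≤ m) {t t' : ℝ} (ht : t ≤ t')
    (hu : ∀ k, n ≤ k → k < m → ¬ (t ≤ u k ∧ u k < t')) :
    (localDiscrepancy u n t' - localDiscrepancy u n t)
      - (localDiscrepancy u m t' - localDiscrepancy u m t) = (m - n) * (t' - t) := by
  have h1 := localDiscrepancy_sub u h t
  have h2 := localDiscrepancy_sub u h t'
  have h3 : (∑ k ∈ Finset.Ico n m, if u k < t then (1 : ℝ) else 0)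
      = ∑ k ∈ Finset.Ico n m, if u k < t' then (1 : ℝ) else 0 := by
    refine Finset.sum_congr rfl fun k hk => ?_
    rw [Finset.mem_Ico] at hk
    have := hu k hk.1 hk.2
    congr 1
    refine propext ⟨fun h => h.trans_le ht, fun h => ?_⟩
    by_contra h'
    exact this ⟨not_lt.1 h', h⟩
  rw [h3] at h1
  linarith

/-- A sum over a grid is at least half the sum of `φ j + φ (j + d)` over any set of grid points. -/
theorem card_mul_le_two_mul_sum_range {φ : ℕ → ℝ} (hφ : ∀ j, 0 ≤ φ j) {Q d : ℕ} {c : ℝ}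
    {G : Finset ℕ} (hG : ∀ j ∈ G, j + d < Q) (hc : ∀ j ∈ G, c ≤ φ j + φ (j + d)) :
    G.card * c ≤ 2 * ∑ j ∈ Finset.range Q, φ j := by
  have h1 : ∑ j ∈ G, φ j ≤ ∑ j ∈ Finset.range Q, φ j :=
    Finset.sum_le_sum_of_subset_of_nonneg
      (fun j hj => Finset.mem_range.2 (by have := hG j hj; omega)) fun j _ _ => hφ j
  have h2 : ∑ j ∈ G, φ (j + d) ≤ ∑ j ∈ Finset.range Q, φ j := by
    have h3 := Finset.sum_map G (addRightEmbedding d) φ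
    simp only [addRightEmbedding_apply] at h3
    rw [← h3]
    refine Finset.sum_le_sum_of_subset_of_nonneg (fun j hj => ?_) fun j _ _ => hφ j
    obtain ⟨i, hi, rfl⟩ := Finset.mem_map.1 hj
    exact Finset.mem_range.2 (hG i hi)
  calc G.card * c = ∑ j ∈ G, c := by simp
    _ ≤ ∑ j ∈ G, (φ j + φ (j + d)) := Finset.sum_le_sum hc
    _ ≤ _ := by rw [Finset.sum_add_distrib]; linarith

/-- Each of the `K` terms of `u` lies in at most `d` of the intervals `[j/Q,(j+d)/Q)`. -/
theorem exists_empty_intervals {u : ℕ → ℝ} (hu : ∀ k, 0 ≤ u k) (a K : ℕ) {Q d : ℕ} (hQ : 0 < Q) :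
    ∃ G : Finset ℕ, (∀ j ∈ G, j + d < Q) ∧ Q ≤ G.card + (K + 1) * d ∧
      ∀ j ∈ G, ∀ k, a ≤ k → k < a + K → ¬ ((j : ℝ) / Q ≤ u k ∧ u k < ((j + d : ℕ) : ℝ) / Q) := by
  have hQ' : (0 : ℝ) < Q := by exact_mod_cast hQ
  let B : Finset ℕ := (Finset.Ico a (a + K)).biUnion fun k =>
    Finset.Ico (⌊u k * Q⌋₊ + 1 - d) (⌊u k * Q⌋₊ + 1)
  have hB : B.card ≤ K * d := by
    refine (Finset.card_biUnion_le_card_mul _ _ d fun k _ => ?_).trans_eq (by simp)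
    rw [Nat.card_Ico]
    omega
  refine ⟨Finset.range (Q - d) \ B, fun j hj => ?_, ?_, fun j hj k hk hk' hjk => ?_⟩
  · have := Finset.mem_range.1 (Finset.mem_sdiff.1 hj).1
    omega
  · have h1 := Finset.le_card_sdiff B (Finset.range (Q - d))
    rw [Finset.card_range] at h1
    rw [add_mul]
    omega
  · refine (Finset.mem_sdiff.1 hj).2 (Finset.mem_biUnion.2 ⟨k, Finset.mem_Ico.2 ⟨hk, hk'⟩, ?_⟩)
    have h1 : j ≤ ⌊u k * Q⌋₊ := Nat.le_floor ((div_le_iff₀ hQ').1 hjk.1)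
    have h2 : ⌊u k * Q⌋₊ < j + d :=
      (Nat.floor_lt (mul_nonneg (hu k) hQ'.le)).2 ((lt_div_iff₀ hQ').1 hjk.2)
    rw [Finset.mem_Ico]
    omega

theorem Ico_add_four_pow_nonempty (a s : ℕ) : (Finset.Ico a (a + 4 ^ s)).Nonempty :=
  Finset.nonempty_Ico.2 (Nat.lt_add_of_pos_right (by positivity))

/-- Lower bound for the oscillation over a block of `4 ^ s` consecutive times, summed over the grid
`j / 4 ^ (T+1)`. From a block to a block four times as long the sum grows by `4 ^ (T+1) / 32`: the
grid intervals of length `1/4 ^ (s+2)` are mostly empty during the long block, and an empty one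
separates the mid-ranges over the first and the last quarter at one of its end points. -/
theorem sum_oscillationOn_ge {u : ℕ → ℝ} (hu : ∀ k, 0 ≤ u k) (T : ℕ) :
    ∀ s ≤ T, ∀ a : ℕ, (s : ℝ) / 32 * 4 ^ (T + 1) ≤ ∑ j ∈ Finset.range (4 ^ (T + 1)),
      oscillationOn (Finset.Ico a (a + 4 ^ s)) (Ico_add_four_pow_nonempty a s)
        (fun n => localDiscrepancy u n (j / 4 ^ (T + 1))) := by
  intro s
  induction s with
  | zero =>
    intro _ a
    simp only [Nat.cast_zero, zero_div, zero_mul]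
    exact Finset.sum_nonneg fun j _ => oscillationOn_nonneg _ _ _
  | succ s ih =>
    intro hs a
    obtain ⟨r, rfl⟩ := Nat.exists_eq_add_of_le hs
    set T := s + 1 + r with hT
    have hpow : 4 ^ (s + 1) = 4 * 4 ^ s := by rw [pow_succ]; ring
    let L := Finset.Ico a (a + 4 ^ s)
    let L' := Finset.Ico (a + 3 * 4 ^ s) (a + 3 * 4 ^ s + 4 ^ s)
    have hL : L.Nonempty := Ico_add_four_pow_nonempty a s
    have hL' : L'.Nonempty := Ico_add_four_pow_nonempty (a + 3 * 4 ^ s) s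
    have hLM : L ⊆ Finset.Ico a (a + 4 ^ (s + 1)) := Finset.Ico_subset_Ico le_rfl (by omega)
    have hLM' : L' ⊆ Finset.Ico a (a + 4 ^ (s + 1)) := Finset.Ico_subset_Ico (by omega) (by omega)
    let D : ℕ → ℕ → ℝ := fun j n => localDiscrepancy u n (j / 4 ^ (T + 1))
    let φ : ℕ → ℝ := fun j => |midrangeOn L hL (D j) - midrangeOn L' hL' (D j)|
    obtain ⟨G, hG, hcard, hempty⟩ := exists_empty_intervals hu a (4 ^ (s + 1)) (Q := 4 ^ (T + 1))
      (d := 4 ^ r) (by positivity)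
    have hgap : ∀ j ∈ G, 1 / 8 ≤ φ j + φ (j + 4 ^ r) := by
      intro j hj
      refine le_abs_midrangeOn_sub_add hL hL' fun n hn n' hn' => ?_
      rw [Finset.mem_Ico] at hn hn'
      have hnn : n + 2 * 4 ^ s ≤ n' := by omega
      have hnn' : (2 : ℝ) * 4 ^ s ≤ n' - n := by
        have : ((n + 2 * 4 ^ s : ℕ) : ℝ) ≤ n' := by exact_mod_cast hnn
        push_cast at this
        linarith
      have he : ((j + 4 ^ r : ℕ) : ℝ) / 4 ^ (T + 1) - j / 4 ^ (T + 1) = 4 ^ r / 4 ^ (T + 1) := by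
        push_cast
        ring
      have hpos : (0 : ℝ) ≤ 4 ^ r / 4 ^ (T + 1) := by positivity
      have hd := localDiscrepancy_interval_sub u (n := n) (m := n') (by omega)
        (t := j / 4 ^ (T + 1)) (t' := ((j + 4 ^ r : ℕ) : ℝ) / 4 ^ (T + 1)) (by linarith)
        fun k hk hk' => by
          have := hempty j hj k (by omega) (by omega)
          push_cast at this ⊢
          exact this
      simp only [D]
      rw [hd, he]
      calc (1 : ℝ) / 8 = 2 * 4 ^ s * (4 ^ r / 4 ^ (T + 1)) := by
            rw [hT, show s + 1 + r + 1 = s + r + 2 by ring, pow_add, pow_add]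
            field_simp
            norm_num
        _ ≤ _ := mul_le_mul_of_nonneg_right hnn' hpos
    have hφ : (4 : ℝ) ^ (T + 1) / 32 ≤ ∑ j ∈ Finset.range (4 ^ (T + 1)), φ j := by
      have h1 := card_mul_le_two_mul_sum_range (fun j => abs_nonneg _) hG hgap
      have h2 : 4 ^ (T + 1) ≤ 2 * G.card := by
        have e1 : 4 ^ (s + 1) * 4 ^ r = 4 ^ T := by rw [hT, pow_add 4 (s + 1)]
        have e2 : 4 ^ (T + 1) = 4 * 4 ^ T := by rw [pow_succ]; ring
        have e3 : 4 ^ r ≤ 4 ^ T := Nat.pow_le_pow_right (by norm_num) (by omega)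
        rw [add_mul, one_mul, e1] at hcard
        omega
      have h3 : (4 : ℝ) ^ (T + 1) ≤ 2 * G.card := by exact_mod_cast h2
      linarith
    have h1 := ih (by omega) a
    have h2 := ih (by omega) (a + 3 * 4 ^ s)
    calc ((s + 1 : ℕ) : ℝ) / 32 * 4 ^ (T + 1)
        = ((s : ℝ) / 32 * 4 ^ (T + 1) + (s : ℝ) / 32 * 4 ^ (T + 1)) / 2 + 4 ^ (T + 1) / 32 := by
          push_cast
          ring
      _ ≤ (∑ j ∈ Finset.range (4 ^ (T + 1)), oscillationOn L hL (D j)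
            + ∑ j ∈ Finset.range (4 ^ (T + 1)), oscillationOn L' hL' (D j)) / 2
            + ∑ j ∈ Finset.range (4 ^ (T + 1)), φ j :=
          add_le_add (div_le_div_of_nonneg_right (add_le_add h1 h2) (by norm_num)) hφ
      _ = ∑ j ∈ Finset.range (4 ^ (T + 1)),
            ((oscillationOn L hL (D j) + oscillationOn L' hL' (D j)) / 2 + φ j) := by
          rw [Finset.sum_add_distrib, ← Finset.sum_div, Finset.sum_add_distrib]
      _ ≤ _ := Finset.sum_le_sum fun j _ =>
          oscillationOn_superset_ge hL hL' (Ico_add_four_pow_nonempty a (s + 1)) hLM hLM' _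

/-- Schmidt's theorem in finite form. -/
theorem exists_le_abs_localDiscrepancy {u : ℕ → ℝ} (hu : ∀ k, 0 ≤ u k) (T : ℕ) :
    ∃ n < 4 ^ T, ∃ t : ℝ, 0 ≤ t ∧ t ≤ 1 ∧ (T : ℝ) / 64 ≤ |localDiscrepancy u n t| := by
  have h := sum_oscillationOn_ge hu T T le_rfl 0
  have hconst : (T : ℝ) / 32 * 4 ^ (T + 1)
      = ∑ j ∈ Finset.range (4 ^ (T + 1)), (T : ℝ) / 32 := by
    simp [mul_comm]
  rw [hconst] at h
  obtain ⟨j, hj, hle⟩ := Finset.exists_le_of_sum_le ⟨0, by simp⟩ h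
  have hj' : (j : ℝ) ≤ 4 ^ (T + 1) := by exact_mod_cast (Finset.mem_range.1 hj).le
  have ht : (j : ℝ) / 4 ^ (T + 1) ≤ 1 := div_le_one_of_le₀ hj' (by positivity)
  set f : ℕ → ℝ := fun n => localDiscrepancy u n (j / 4 ^ (T + 1)) with hf
  obtain ⟨n, hn, hsup⟩ := Finset.exists_mem_eq_sup' (Ico_add_four_pow_nonempty 0 T) f
  obtain ⟨m, hm, hinf⟩ := Finset.exists_mem_eq_inf' (Ico_add_four_pow_nonempty 0 T) f
  rw [oscillationOn, hsup, hinf] at hle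
  rw [Finset.mem_Ico] at hn hm
  rcases le_or_gt ((T : ℝ) / 64) |f n| with hfn | hfn
  · exact ⟨n, by omega, _, by positivity, ht, hfn⟩
  · refine ⟨m, by omega, _, by positivity, ht, ?_⟩
    linarith [le_abs_self (f n), neg_abs_le (f m)]

/-! ### The four bounds -/

theorem one_div_two_mul_le_starDiscrepancy (μ : Measure unitInterval) [IsProbabilityMeasure μ]
    (hμ : ∀ y, μ {y} = 0) {N : ℕ} (hN : 1 ≤ N) (x : Fin N → unitInterval) :
    1 / (2 * (N : ℝ)) ≤ starDiscrepancy μ (empiricalMeasure x) := by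
  have hN' : (1 : ℝ) ≤ N := by exact_mod_cast hN
  obtain ⟨b, hb, -⟩ := exists_measureReal_Iio_eq μ hμ (t := 1 / (2 * (N : ℝ))) (by positivity)
    (by rw [div_le_one (by positivity)]; linarith)
  refine le_trans ?_ (le_starDiscrepancy μ x b)
  -- The empirical measure takes values in `ℤ / N`, and the level `1 / (2N)` is as far as possible
  -- from this set.
  rw [hb, empiricalMeasure_real_Iio, Finset.sum_boole]
  rcases Nat.eq_zero_or_pos (Finset.univ.filter fun i => x i < b).card with h | h
  · rw [h]
    simp only [Nat.cast_zero, zero_div, sub_zero]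
    exact le_abs_self _
  · have h1 : (1 : ℝ) ≤ (Finset.univ.filter fun i => x i < b).card := by exact_mod_cast h
    have h2 : (1 : ℝ) / N ≤ (Finset.univ.filter fun i => x i < b).card / N := by gcongr
    have h3 : (1 : ℝ) / N = 1 / (2 * N) + 1 / (2 * N) := by field_simp; norm_num
    rw [abs_sub_comm]
    exact le_trans (by linarith) (le_abs_self _)

theorem infinite_setOf_log_div_le_starDiscrepancy (μ : Measure unitInterval)
    [IsProbabilityMeasure μ] (hμ : ∀ y, μ {y} = 0) (x : ℕ → unitInterval) :
    {N : ℕ | 1 / 128 * (Real.log (N : ℝ) / (N : ℝ))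
      ≤ starDiscrepancy μ (empiricalMeasure (fun i : Fin N => x i))}.Infinite := by
  refine Set.infinite_of_not_bddAbove ?_
  rintro ⟨B, hB⟩
  obtain ⟨T, hT⟩ : ∃ T : ℕ, (T : ℝ) = 64 * (B + 1) := ⟨64 * (B + 1), by push_cast; ring⟩
  obtain ⟨n, hn, t, h0, h1, hle⟩ := exists_le_abs_localDiscrepancy
    (u := fun k => μ.real (Set.Iio (x k))) (fun k => measureReal_nonneg) T
  have hB0 : (0 : ℝ) ≤ B := Nat.cast_nonneg B
  have hn1 : 1 ≤ n := by
    rw [Nat.one_le_iff_ne_zero]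
    rintro rfl
    simp [localDiscrepancy] at hle
    linarith
  have hn' : (0 : ℝ) < n := by exact_mod_cast hn1
  have hD := abs_localDiscrepancy_le_starDiscrepancy μ hμ x hn1 h0 h1
  rw [div_le_iff₀ hn'] at hD
  -- The discrepancy is at most `1`, so that a large local discrepancy forces `n` to be large.
  have hnB : (B : ℝ) < n := by
    have := mul_le_mul_of_nonneg_right
      (starDiscrepancy_le_one μ (fun i : Fin n => x i)) hn'.le
    linarith
  have hlog : Real.log n ≤ T * 2 := by
    have h4 : Real.log n ≤ Real.log ((4 : ℝ) ^ T) :=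
      Real.log_le_log hn' (by exact_mod_cast hn.le)
    rw [Real.log_pow, show (4 : ℝ) = 2 ^ 2 by norm_num, Real.log_pow] at h4
    push_cast at h4
    nlinarith [Real.log_two_lt_d9]
  refine absurd (hB (show n ∈ _ from ?_)) (not_le.2 (by exact_mod_cast hnB))
  rw [Set.mem_ofPred_eq, ← mul_div_assoc, div_le_iff₀ hn']
  linarith

theorem theorem3p2 :
    -- (1) finite point sets, for an arbitrary Borel probability measure
    (∃ c : ℝ, 0 < c ∧
      ∀ (μ : Measure unitInterval), IsProbabilityMeasure μ →
        ∀ N : ℕ, 1 ≤ N → ∃ x : Fin N → unitInterval,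
          starDiscrepancy μ (empiricalMeasure x) ≤ c / (N : ℝ)) ∧
    -- (2) infinite sequences, for an arbitrary Borel probability measure
    (∃ c : ℝ, 0 < c ∧
      ∀ (μ : Measure unitInterval), IsProbabilityMeasure μ →
        ∃ x : ℕ → unitInterval, ∀ N : ℕ, 2 ≤ N →
          starDiscrepancy μ (empiricalMeasure (fun i : Fin N => x i))
            ≤ c * (Real.log (N : ℝ) / (N : ℝ))) ∧
    -- (3) lower bound for finite point sets, for measures without point masses
    (∀ (μ : Measure unitInterval), IsProbabilityMeasure μ → (∀ y, μ {y} = 0) →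
      ∀ N : ℕ, 1 ≤ N → ∀ x : Fin N → unitInterval,
        1 / (2 * (N : ℝ)) ≤ starDiscrepancy μ (empiricalMeasure x)) ∧
    -- (3) lower bound for sequences, for measures without point masses
    (∃ c : ℝ, 0 < c ∧
      ∀ (μ : Measure unitInterval), IsProbabilityMeasure μ → (∀ y, μ {y} = 0) →
        ∀ x : ℕ → unitInterval,
          {N : ℕ | c * (Real.log (N : ℝ) / (N : ℝ))
            ≤ starDiscrepancy μ (empiricalMeasure (fun i : Fin N => x i))}.Infinite) := by
  refine ⟨⟨1, one_pos, fun μ _ N hN => ?_⟩, ⟨5, by norm_num, fun μ _ => ?_⟩,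
    fun μ _ hμ N hN x => one_div_two_mul_le_starDiscrepancy μ hμ hN x,
    ⟨1 / 128, by norm_num, fun μ _ hμ x => infinite_setOf_log_div_le_starDiscrepancy μ hμ x⟩⟩
  · exact ⟨fun i => quantile μ ((i : ℕ) / N),
      starDiscrepancy_quantile_le μ (u := fun k => (k : ℝ) / N) (fun k => by positivity) hN
        fun t h0 h1 => abs_localDiscrepancy_equispaced_le hN h0 h1⟩
  · refine ⟨fun k => quantile μ (vanDerCorput k), fun N hN => ?_⟩
    rw [← mul_div_assoc]
    exact starDiscrepancy_quantile_le μ (fun k => (vanDerCorput_nonneg_and_lt_one k).1) (by omega)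
      fun t h0 h1 => abs_localDiscrepancy_vanDerCorput_le_log hN h0 h1
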